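/- Let $n$ be a positive integer, let $\mathbb{S}^n$ be the Euclidean unit $n$-sphere in $\mathbb{R}^{n+1}$, and let $d$ be the angular distance on $\mathbb{S}^n$, i.e. $d(x,y)\in[0,\pi]$ is the angle between the unit vectors $x$ and $y$. For a continuous map $f\colon \mathbb{S}^n\to\mathbb{R}^{n+1}$, call two distinct points $a,b\in\mathbb{S}^n$ topological $f$-neighbors if either $f(a)=f(b)$, or some path in $\mathbb{R}^{n+1}$ with endpoints $f(a)$ and $f(b)$ intersects $f(\mathbb{S}^n)$ only at these two points. Let $$\Omega_f^{\mathrm{top}}=\{\,d(a,b) : a \text{ and } b \text{ in } \mathbb{S}^n \text{ are topological } f\text{-neighbors}\,\}\subset\mathbb{R}.$$ Then there exists a sequence of continuous maps $(f_k\colon\mathbb{S}^n\to\mathbb{R}^{n+1})_{k=1}^\infty$ such that each set $\Omega_{f_k}^{\mathrm{top}}$ is Lebesgue measurable and $$\lim_{k\to\infty}\mu\bigl(\Omega_{f_k}^{\mathrm{top}}\bigr)=0,$$ where $\mu$ is the Lebesgue measure on $\mathbb{R}$. -/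

import Mathlib

open MeasureTheory Filter Topology

/-- Distinct points `a` and `b` are topological `f`-neighbors if either `f a = f b`, or some path in
`ℝ^m` with endpoints `f a` and `f b` intersects the image of `f` only at these two points. -/
def IsTopologicalNeighbor {M : Type*} {m : ℕ} (f : M → EuclideanSpace ℝ (Fin m)) (a b : M) : Prop :=
  a ≠ b ∧ (f a = f b ∨ ∃ γ : Path (f a) (f b), Set.range γ ∩ Set.range f = {f a, f b})

/-- The set `Ω_f^top` of all distances, with respect to the distance function `d`, between
topological `f`-neighbors. -/
def topologicalDistanceSet {M : Type*} {m : ℕ} (d : M → M → ℝ)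
    (f : M → EuclideanSpace ℝ (Fin m)) : Set ℝ :=
  {r : ℝ | ∃ a b : M, IsTopologicalNeighbor f a b ∧ d a b = r}

/-- The unit `n`-sphere in Euclidean `(n + 1)`-space. -/
abbrev UnitSphere (n : ℕ) : Type :=
  Metric.sphere (0 : EuclideanSpace ℝ (Fin (n + 1))) 1

/-- The angular distance on the unit sphere: the angle in `[0, π]` between two unit vectors. -/
noncomputable def angularDist {n : ℕ} (x y : UnitSphere n) : ℝ :=
  InnerProductGeometry.angle (x : EuclideanSpace ℝ (Fin (n + 1))) (y : EuclideanSpace ℝ (Fin (n + 1)))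

/-! For small ρ, a map f uniformly 9ρ-close to the inclusion is built whose image contains the shell
K of points within ρ of the unit sphere, and which sends every point outside a thin set E into the
interior of its image (`exists_shell_filling_map`). A path cannot leave an interior point of the
image without meeting the image again (`notMem_interior_of_path`), so neighbors with distinct images
both lie in E, whose distances form a null set. Neighbors with equal images are within 18ρ of each
other. Hence, up to a null set, the distance set is a compact subset of a short interval [0, Cρ].

E is a finite union of Cantor sets, one near each point of a ρ-net. A Cantor set maps continuously
onto any nonempty compact metric space, so E can be mapped onto K by small displacements; Tietze
extends the displacement to the sphere, and a radial push moves points off E strictly inside K. -/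

/-! ### Thin Cantor sets and null sets of values -/

/-- Removing a common first digit rescales the difference by 1/8. The ratio is below 1/4 so that the
4 ^ k pairs of depth-k cylinders have total length tending to 0. -/
lemma abs_cantorFunction_sub_le (k : ℕ) (c d : ℕ → Bool) (h : ∀ i < k, c i = d i) :
    |Cardinal.cantorFunction (1 / 8) c - Cardinal.cantorFunction (1 / 8) d| ≤ 2 * (1 / 8) ^ k := by
  have bound : ∀ c : ℕ → Bool, 0 ≤ Cardinal.cantorFunction (1 / 8) c ∧
      Cardinal.cantorFunction (1 / 8) c ≤ 2 := by
    intro c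
    refine ⟨tsum_nonneg fun n => Cardinal.cantorFunctionAux_nonneg (by norm_num), ?_⟩
    refine (Cardinal.cantorFunction_le (g := fun _ => true) (by norm_num) (by norm_num)
      (fun _ _ => rfl)).trans ?_
    simp only [Cardinal.cantorFunction, Cardinal.cantorFunctionAux, cond_true]
    rw [tsum_geometric_of_lt_one (by norm_num) (by norm_num)]
    norm_num
  induction k generalizing c d with
  | zero =>
    have h1 := bound c
    have h2 := bound d
    rw [abs_le]
    constructor <;> simp <;> linarith
  | succ k ih =>
    rw [Cardinal.cantorFunction_succ c (by norm_num) (by norm_num),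
      Cardinal.cantorFunction_succ d (by norm_num) (by norm_num), h 0 (by omega),
      add_sub_add_left_eq_sub, ← mul_sub, abs_mul, abs_of_pos (by norm_num : (0 : ℝ) < 1 / 8),
      pow_succ]
    have := ih (fun n => c (n + 1)) (fun n => d (n + 1)) fun i hi => h _ (by omega)
    linarith

lemma continuous_cantorFunction {r : ℝ} (h0 : 0 ≤ r) (h1 : r < 1) :
    Continuous (Cardinal.cantorFunction r) := by
  refine continuous_tsum (u := fun n => r ^ n) (fun n => ?_)
    (summable_geometric_of_lt_one h0 h1) fun n c => ?_
  · exact (continuous_of_discreteTopology (f := fun b : Bool => cond b (r ^ n) 0)).comp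
      (continuous_apply n)
  · cases h : c n <;> simp [h, h0, abs_of_nonneg]

/-- A function of two points of the Cantor space that oscillates by at most `C * 8 ^ (-k)` on pairs
of cylinders of depth `k` has a null range. -/
lemma volume_range_eq_zero_of_cylinder_bound (h : (ℕ → Bool) → (ℕ → Bool) → ℝ) (C : ℝ)
    (hh : ∀ (k : ℕ) (c d c' d' : ℕ → Bool), (∀ i < k, c i = d i) → (∀ i < k, c' i = d' i) →
      |h c c' - h d d'| ≤ C * (1 / 8) ^ k) :
    volume {r : ℝ | ∃ c d, h c d = r} = 0 := by
  have key : ∀ k : ℕ, volume {r : ℝ | ∃ c d, h c d = r} ≤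
      ENNReal.ofReal (2 * C * (1 / 2) ^ k) := by
    intro k
    -- Each word is padded by `false` to give a representative of its cylinder.
    let ext : (Fin k → Bool) → ℕ → Bool := fun w i => if hi : i < k then w ⟨i, hi⟩ else false
    have hsub : {r : ℝ | ∃ c d, h c d = r} ⊆ ⋃ w : (Fin k → Bool) × (Fin k → Bool),
        Metric.closedBall (h (ext w.1) (ext w.2)) (C * (1 / 8) ^ k) := by
      rintro r ⟨c, d, rfl⟩
      refine Set.mem_iUnion.2 ⟨(fun i => c i, fun i => d i), ?_⟩
      rw [Metric.mem_closedBall, Real.dist_eq]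
      refine hh k _ _ _ _ ?_ ?_ <;> intro i hi <;> simp [ext, hi]
    refine (measure_mono hsub).trans ((measure_iUnion_fintype_le _ _).trans ?_)
    simp only [Real.volume_closedBall, Finset.sum_const, Finset.card_univ, Fintype.card_prod,
      Fintype.card_fun, Fintype.card_bool, Fintype.card_fin, nsmul_eq_mul]
    rw [← ENNReal.ofReal_natCast, ← ENNReal.ofReal_mul (by positivity)]
    refine le_of_eq (congrArg _ ?_)
    push_cast
    have : ((1 : ℝ) / 2) ^ k = 2 ^ k * 2 ^ k * (1 / 8) ^ k := by
      rw [← mul_pow, ← mul_pow]; norm_num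
    rw [this]; ring
  have hlim : Tendsto (fun k : ℕ => ENNReal.ofReal (2 * C * (1 / 2) ^ k)) atTop (𝓝 0) := by
    have := (tendsto_pow_atTop_nhds_zero_of_lt_one (r := (1 / 2 : ℝ)) (by norm_num)
      (by norm_num)).const_mul (2 * C)
    rw [mul_zero] at this
    simpa using ENNReal.tendsto_ofReal this
  exact le_antisymm (ge_of_tendsto' hlim key) bot_le

/-! ### Angular distance on the sphere -/

section Angle

variable {n : ℕ}

lemma cos_angularDist (a b : UnitSphere n) :
    Real.cos (angularDist a b) = inner ℝ (a : EuclideanSpace ℝ (Fin (n + 1))) b := by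
  rw [angularDist, InnerProductGeometry.cos_angle]
  simp

lemma dist_sq_eq_angularDist (a b : UnitSphere n) :
    dist a b ^ 2 = 2 - 2 * Real.cos (angularDist a b) := by
  rw [Subtype.dist_eq, dist_eq_norm, norm_sub_sq_real, cos_angularDist]
  simp; ring

lemma angularDist_nonneg (a b : UnitSphere n) : 0 ≤ angularDist a b :=
  InnerProductGeometry.angle_nonneg _ _

lemma angularDist_comm (a b : UnitSphere n) : angularDist a b = angularDist b a :=
  InnerProductGeometry.angle_comm _ _

lemma angularDist_triangle (a b c : UnitSphere n) :
    angularDist a c ≤ angularDist a b + angularDist b c :=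
  InnerProductGeometry.angle_le_angle_add_angle _ _ _

lemma abs_angularDist_sub_le (a b a' b' : UnitSphere n) :
    |angularDist a b - angularDist a' b'| ≤ angularDist a a' + angularDist b b' := by
  have h1 := angularDist_triangle a a' b
  have h2 := angularDist_triangle a' b' b
  have h3 := angularDist_triangle a' a b'
  have h4 := angularDist_triangle a b b'
  rw [angularDist_comm a' a] at h3
  rw [angularDist_comm b' b] at h2
  rw [abs_le]
  constructor <;> linarith

lemma dist_le_angularDist (a b : UnitSphere n) : dist a b ≤ angularDist a b := by
  refine le_of_sq_le_sq ?_ (angularDist_nonneg a b)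
  have := Real.one_sub_sq_div_two_le_cos (x := angularDist a b)
  rw [dist_sq_eq_angularDist]; linarith

lemma angularDist_le_mul_dist (a b : UnitSphere n) :
    angularDist a b ≤ Real.pi / 2 * dist a b := by
  refine le_of_sq_le_sq ?_ (by positivity)
  have h := Real.cos_le_one_sub_mul_cos_sq (x := angularDist a b)
    (by rw [abs_of_nonneg (angularDist_nonneg a b)]; exact InnerProductGeometry.angle_le_pi _ _)
  rw [mul_pow, dist_sq_eq_angularDist]
  have hpi : 0 < Real.pi ^ 2 := by positivity
  have : 2 / Real.pi ^ 2 * angularDist a b ^ 2 * Real.pi ^ 2 = 2 * angularDist a b ^ 2 := by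
    field_simp
  nlinarith

lemma angularDist_self (a : UnitSphere n) : angularDist a a = 0 :=
  InnerProductGeometry.angle_self (by simp [← norm_ne_zero_iff])

lemma continuous_angularDist :
    Continuous fun p : UnitSphere n × UnitSphere n => angularDist p.1 p.2 := by
  rw [continuous_iff_continuousAt]
  intro p
  have := InnerProductGeometry.continuousAt_angle
    (x := ((p.1 : EuclideanSpace ℝ (Fin (n + 1))), (p.2 : EuclideanSpace ℝ (Fin (n + 1)))))
    (by simp [← norm_ne_zero_iff]) (by simp [← norm_ne_zero_iff])
  exact this.comp (f := fun p : UnitSphere n × UnitSphere n =>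
    ((p.1 : EuclideanSpace ℝ (Fin (n + 1))), (p.2 : EuclideanSpace ℝ (Fin (n + 1)))))
    (by fun_prop)

/-- Arbitrarily close to every point of the sphere there is a thin Cantor set. -/
lemma exists_thin_cantor_map (hn : 1 ≤ n) (x : UnitSphere n) {η : ℝ} (hη : 0 < η) (hη1 : η ≤ 1) :
    ∃ φ : (ℕ → Bool) → UnitSphere n, Continuous φ ∧ Function.Injective φ ∧
      (∀ c, dist (φ c) x ≤ η) ∧
      ∀ (k : ℕ) (c d : ℕ → Bool), (∀ i < k, c i = d i) →
        angularDist (φ c) (φ d) ≤ η * (1 / 8) ^ k := by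
  obtain ⟨v, hv1, hv⟩ : ∃ v : EuclideanSpace ℝ (Fin (n + 1)), ‖v‖ = 1 ∧
      inner ℝ (x : EuclideanSpace ℝ (Fin (n + 1))) v = 0 := by
    have : 0 < Module.finrank ℝ (ℝ ∙ (x : EuclideanSpace ℝ (Fin (n + 1))))ᗮ := by
      have h1 := Submodule.finrank_add_finrank_orthogonal
        (ℝ ∙ (x : EuclideanSpace ℝ (Fin (n + 1))))
      have h2 := finrank_span_singleton (K := ℝ) (v := (x : EuclideanSpace ℝ (Fin (n + 1))))
        (by simp [← norm_ne_zero_iff])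
      rw [h2, finrank_euclideanSpace_fin] at h1
      omega
    have := Module.finrank_pos_iff.1 this
    obtain ⟨w, hw⟩ := exists_norm_eq (ℝ ∙ (x : EuclideanSpace ℝ (Fin (n + 1))))ᗮ zero_le_one
    exact ⟨w, hw, Submodule.mem_orthogonal_singleton_iff_inner_right.1 w.2⟩
  -- The factor η / 2 absorbs the constant 2 of `abs_cantorFunction_sub_le`; ψ below then wraps θ
  -- along a great circle through x.
  set θ : (ℕ → Bool) → ℝ := fun c => η / 2 * Cardinal.cantorFunction (1 / 8) c with hθ
  have hθk : ∀ (k : ℕ) (c d : ℕ → Bool), (∀ i < k, c i = d i) → |θ c - θ d| ≤ η * (1 / 8) ^ k := by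
    intro k c d h
    have := abs_cantorFunction_sub_le k c d h
    rw [hθ, ← mul_sub, abs_mul, abs_of_pos (by positivity)]
    nlinarith
  have hθc : Continuous θ :=
    continuous_const.mul (continuous_cantorFunction (by norm_num) (by norm_num))
  have hθi : Function.Injective θ := fun c d h =>
    Cardinal.cantorFunction_injective (by norm_num) (by norm_num)
      (mul_left_cancel₀ (by positivity) h)
  have hx : inner ℝ (x : EuclideanSpace ℝ (Fin (n + 1))) x = 1 := by simp
  have hvv : inner ℝ v v = 1 := by rw [real_inner_self_eq_norm_sq, hv1]; norm_num
  have hv' : inner ℝ v (x : EuclideanSpace ℝ (Fin (n + 1))) = 0 := by rw [real_inner_comm, hv]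
  have hinner : ∀ s t : ℝ, inner ℝ (Real.cos s • (x : EuclideanSpace ℝ (Fin (n + 1))) +
      Real.sin s • v) (Real.cos t • (x : EuclideanSpace ℝ (Fin (n + 1))) + Real.sin t • v) =
      Real.cos (s - t) := by
    intro s t
    simp only [inner_add_left, inner_add_right, real_inner_smul_left, real_inner_smul_right, hx,
      hvv, hv, hv', Real.cos_sub]
    ring
  let ψ : ℝ → UnitSphere n := fun t =>
    ⟨Real.cos t • (x : EuclideanSpace ℝ (Fin (n + 1))) + Real.sin t • v, by
      rw [mem_sphere_zero_iff_norm, ← sq_eq_sq₀ (norm_nonneg _) zero_le_one,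
        ← real_inner_self_eq_norm_sq, hinner]
      simp⟩
  have hψc : Continuous ψ := by
    refine Continuous.subtype_mk ?_ _
    fun_prop
  have hψ0 : ψ 0 = x := Subtype.ext (by simp [ψ])
  have hψ : ∀ s t, |s - t| ≤ 1 → angularDist (ψ s) (ψ t) = |s - t| := by
    intro s t hst
    have h : Real.cos (angularDist (ψ s) (ψ t)) = Real.cos |s - t| := by
      rw [cos_angularDist, Real.cos_abs]
      exact hinner s t
    exact Real.injOn_cos ⟨angularDist_nonneg _ _, InnerProductGeometry.angle_le_pi _ _⟩
      ⟨abs_nonneg _, hst.trans (by linarith [Real.pi_gt_three])⟩ h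
  have hθ1 : ∀ c d, |θ c - θ d| ≤ 1 := fun c d => (hθk 0 c d (by simp)).trans (by simpa using hη1)
  have hθ0 : θ (fun _ => false) = 0 := by
    simp [hθ, Cardinal.cantorFunction, Cardinal.cantorFunctionAux]
  refine ⟨ψ ∘ θ, hψc.comp hθc, fun c d h => hθi ?_, fun c => ?_, fun k c d h => ?_⟩
  · have := hψ _ _ (hθ1 c d)
    rw [show ψ (θ c) = ψ (θ d) from h, angularDist_self] at this
    exact sub_eq_zero.1 (abs_eq_zero.1 this.symm)
  · refine (dist_le_angularDist _ _).trans ?_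
    have := hψ _ _ (hθ1 c (fun _ => false))
    rw [hθ0, hψ0, ← hθ0] at this
    rw [Function.comp_apply, this]
    simpa using hθk 0 c (fun _ => false) (by simp)
  · rw [Function.comp_apply, Function.comp_apply, hψ _ _ (hθ1 c d)]
    exact hθk k c d h

end Angle

/-! ### Neighbors and interior points of the image -/

/-- A point joined to another one by a path that otherwise avoids a set is not interior to it. -/
lemma notMem_interior_of_path {Y : Type*} [MetricSpace Y] {S : Set Y} {p q : Y} (hpq : p ≠ q)
    (γ : Path p q) (hγ : Set.range γ ∩ S ⊆ {p, q}) : p ∉ interior S := by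
  intro hp
  obtain ⟨s, hs, hball⟩ := Metric.isOpen_iff.1 isOpen_interior p hp
  have hD : 0 < dist q p := dist_pos.2 hpq.symm
  -- The path must cross the sphere of radius e about p, which lies in S and contains neither p nor
  -- q.
  set e := min s (dist q p) / 2 with he
  have he0 : 0 < e := by positivity
  have hes : e < s := by
    have := min_le_left s (dist q p)
    have : 0 < min s (dist q p) := by positivity
    linarith
  have heD : e < dist q p := by
    have := min_le_right s (dist q p)
    have : 0 < min s (dist q p) := by positivity
    linarith
  have hc : Continuous fun t : unitInterval => dist (γ t) p := by fun_prop
  obtain ⟨t, ht⟩ : e ∈ Set.range fun t : unitInterval => dist (γ t) p :=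
    mem_range_of_exists_le_of_exists_ge hc ⟨0, by simpa using he0.le⟩ ⟨1, by simpa using heD.le⟩
  simp only at ht
  have hmem : γ t ∈ ({p, q} : Set Y) :=
    hγ ⟨⟨t, rfl⟩, interior_subset (hball (by rw [Metric.mem_ball, ht]; exact hes))⟩
  rcases hmem with h | h
  · rw [h, dist_self] at ht; exact he0.ne ht
  · rw [h] at ht; exact heD.ne' ht

/-- If topological neighbors are either close to each other and glued, or belong to a set whose
distances form a null set, then the distance set is null-measurable with small measure. -/
lemma topologicalDistanceSet_measure_bound {n : ℕ} (f : C(UnitSphere n, EuclideanSpace ℝ (Fin (n + 1))))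
    (E : Set (UnitSphere n)) (hE : volume {r : ℝ | ∃ a ∈ E, ∃ b ∈ E, angularDist a b = r} = 0)
    (hfE : ∀ x ∉ E, f x ∈ interior (Set.range f)) {ρ : ℝ}
    (hρ : ∀ a b, f a = f b → angularDist a b ≤ ρ) :
    NullMeasurableSet (topologicalDistanceSet angularDist f) (volume : Measure ℝ) ∧
      volume (topologicalDistanceSet angularDist f) ≤ ENNReal.ofReal ρ := by
  set A : Set ℝ := (fun p : UnitSphere n × UnitSphere n => angularDist p.1 p.2) ''
    {p | f p.1 = f p.2} with hA
  have hAc : IsCompact A := by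
    refine IsCompact.image (IsClosed.isCompact ?_) continuous_angularDist
    exact isClosed_eq (by fun_prop) (by fun_prop)
  have hsub : topologicalDistanceSet angularDist f ⊆
      A ∪ {r : ℝ | ∃ a ∈ E, ∃ b ∈ E, angularDist a b = r} := by
    rintro r ⟨a, b, ⟨-, hab⟩, rfl⟩
    by_cases hf : f a = f b
    · exact Or.inl ⟨(a, b), hf, rfl⟩
    · obtain ⟨γ, hγ⟩ := hab.resolve_left hf
      refine Or.inr ⟨a, ?_, b, ?_, rfl⟩
      · by_contra h
        exact notMem_interior_of_path hf γ hγ.subset (hfE a h)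
      · by_contra h
        refine notMem_interior_of_path (Ne.symm hf) γ.symm ?_ (hfE b h)
        rw [Path.symm_range, Set.pair_comm]
        exact hγ.subset
  -- The diagonal, excluded for neighbors, contributes only the distance 0.
  have hsup : A ⊆ topologicalDistanceSet angularDist f ∪ {0} := by
    rintro r ⟨⟨a, b⟩, hf, rfl⟩
    by_cases hab : a = b
    · subst hab
      exact Or.inr (angularDist_self _)
    · exact Or.inl ⟨a, b, ⟨hab, Or.inl hf⟩, rfl⟩
  have hae : topologicalDistanceSet angularDist f =ᵐ[volume] A := by
    refine ae_eq_set.2 ⟨measure_mono_null (fun r hr => ?_) hE,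
      measure_mono_null (fun r hr => ?_) (measure_singleton (0 : ℝ))⟩
    · exact (hsub hr.1).resolve_left hr.2
    · exact (hsup hr.1).resolve_left hr.2
  refine ⟨hAc.measurableSet.nullMeasurableSet.congr hae.symm, ?_⟩
  rw [measure_congr hae]
  refine (measure_mono (t := Set.Icc 0 ρ) ?_).trans (by simp)
  rintro r ⟨⟨a, b⟩, hf, rfl⟩
  exact ⟨angularDist_nonneg _ _, hρ _ _ hf⟩

/-- A finite union of thin Cantor sets that comes close to every point of the sphere, and whose
distances form a null set. -/
lemma exists_dense_cantor_family {n : ℕ} (hn : 1 ≤ n) {ρ : ℝ} (hρ : 0 < ρ) :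
    ∃ (m : ℕ) (x : Fin m → UnitSphere n) (Φ : Fin m → (ℕ → Bool) → UnitSphere n),
      (∀ y, ∃ i, dist y (x i) ≤ ρ) ∧ (∀ i, Continuous (Φ i)) ∧
      (∀ i j c d, Φ i c = Φ j d → i = j ∧ c = d) ∧ (∀ i c, dist (Φ i c) (x i) ≤ ρ) ∧
      volume {r : ℝ | ∃ i c j d, angularDist (Φ i c) (Φ j d) = r} = 0 := by
  obtain ⟨t, -, htf, ht⟩ := finite_cover_balls_of_compact
    (isCompact_univ : IsCompact (Set.univ : Set (UnitSphere n))) hρ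
  have := htf.to_subtype
  obtain ⟨m, ⟨e⟩⟩ := Finite.exists_equiv_fin t
  let x : Fin m → UnitSphere n := fun i => e.symm i
  have hx : Function.Injective x := Subtype.val_injective.comp e.symm.injective
  -- Separation by more than 2η keeps the Cantor sets around distinct centers disjoint.
  obtain ⟨η, hη0, hη1, hηρ, hη⟩ : ∃ η : ℝ, 0 < η ∧ η ≤ 1 ∧ η ≤ ρ ∧
      ∀ i j, i ≠ j → 2 * η < dist (x i) (x j) := by
    have h : ∀ᶠ η : ℝ in 𝓝[>] 0, ∀ i j, i ≠ j → 2 * η < dist (x i) (x j) := by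
      rw [eventually_all]; intro i
      rw [eventually_all]; intro j
      by_cases hij : i = j
      · simp [hij]
      · have h0 : Tendsto (fun η : ℝ => 2 * η) (𝓝[>] 0) (𝓝 0) := by
          refine tendsto_nhdsWithin_of_tendsto_nhds ?_
          exact (Continuous.tendsto' (by fun_prop) _ _ (by simp))
        filter_upwards [h0.eventually_lt_const (dist_pos.2 (hx.ne hij))] with η h _ using h
    have h1 : ∀ᶠ η : ℝ in 𝓝[>] 0, η ∈ Set.Ioc 0 (min 1 ρ) := Ioc_mem_nhdsGT (by positivity)
    obtain ⟨η, h, h1⟩ := (h.and h1).exists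
    exact ⟨η, h1.1, h1.2.trans (min_le_left _ _), h1.2.trans (min_le_right _ _), h⟩
  choose Φ hΦc hΦi hΦd hΦ using fun i => exists_thin_cantor_map hn (x i) hη0 hη1
  refine ⟨m, x, Φ, fun y => ?_, hΦc, fun i j c d h => ?_,
    fun i c => (hΦd i c).trans hηρ, ?_⟩
  · obtain ⟨z, hz, hyz⟩ := Set.mem_iUnion₂.1 (ht (Set.mem_univ y))
    exact ⟨e ⟨z, hz⟩, by simpa [x] using (Metric.mem_ball.1 hyz).le⟩
  · have hij : i = j := by
      by_contra hij
      have h1 := hη i j hij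
      have h2 := hΦd i c
      have h3 := hΦd j d
      rw [← h] at h3
      have h4 := dist_triangle_left (x i) (x j) (Φ i c)
      linarith
    subst hij
    exact ⟨rfl, hΦi i h⟩
  · have : {r : ℝ | ∃ i c j d, angularDist (Φ i c) (Φ j d) = r} =
        ⋃ i, ⋃ j, {r : ℝ | ∃ c d, angularDist (Φ i c) (Φ j d) = r} := by
      ext r; simp only [Set.mem_ofPred_eq, Set.mem_iUnion]
      exact exists_congr fun i => exists_comm
    rw [this]
    refine measure_iUnion_null fun i => measure_iUnion_null fun j => ?_
    refine volume_range_eq_zero_of_cylinder_bound _ (2 * η) fun k c d c' d' h h' => ?_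
    refine (abs_angularDist_sub_le _ _ _ _).trans ?_
    linarith [hΦ i k c d h, hΦ j k c' d' h']

/-! ### Radial push and the shell-filling map -/

/-- Pushing `y` radially into the shell `{y | |‖y‖ - 1| ≤ ρ}`, contracted by the factor `s`. -/
noncomputable def shellPush {V : Type*} [NormedAddCommGroup V] [NormedSpace ℝ V] (ρ s : ℝ) (y : V) :
    V :=
  ((1 + s * max (-ρ) (min ρ (‖y‖ - 1))) / ‖y‖) • y

section ShellPush

variable {V : Type*} [NormedAddCommGroup V] [NormedSpace ℝ V] {ρ s : ℝ} {y : V}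

lemma abs_clamp_le (hρ : 0 ≤ ρ) (t : ℝ) : |max (-ρ) (min ρ t)| ≤ ρ :=
  abs_le.2 ⟨le_max_left _ _, max_le (by linarith) (min_le_left _ _)⟩

lemma shellPush_one (hy : y ≠ 0) (h : |‖y‖ - 1| ≤ ρ) : shellPush ρ 1 y = y := by
  obtain ⟨h1, h2⟩ := abs_le.1 h
  rw [shellPush, min_eq_right h2, max_eq_right h1, one_mul, add_sub_cancel,
    div_self (norm_ne_zero_iff.2 hy), one_smul]

lemma norm_shellPush (hy : y ≠ 0) (hρ : 0 ≤ ρ) (hρ1 : ρ ≤ 1) (hs0 : 0 ≤ s) (hs1 : s ≤ 1) :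
    ‖shellPush ρ s y‖ = 1 + s * max (-ρ) (min ρ (‖y‖ - 1)) := by
  have h := abs_le.1 (abs_clamp_le hρ (‖y‖ - 1))
  have hnn : 0 ≤ 1 + s * max (-ρ) (min ρ (‖y‖ - 1)) := by nlinarith
  rw [shellPush, norm_smul, norm_div, norm_norm, div_mul_cancel₀ _ (norm_ne_zero_iff.2 hy),
    Real.norm_of_nonneg hnn]

lemma norm_shellPush_sub_le (hy : y ≠ 0) (hρ : 0 ≤ ρ) (hs0 : 0 ≤ s) (hs1 : s ≤ 1) :
    ‖shellPush ρ s y - y‖ ≤ ρ + |‖y‖ - 1| := by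
  have hy' := norm_ne_zero_iff.2 hy
  set m := max (-ρ) (min ρ (‖y‖ - 1)) with hm
  have : shellPush ρ s y - y = ((s * m - (‖y‖ - 1)) / ‖y‖) • y := by
    rw [shellPush, ← hm]
    nth_rewrite 3 [← one_smul ℝ y]
    rw [← sub_smul]
    congr 1
    field_simp
    ring
  rw [this, norm_smul, norm_div, norm_norm, div_mul_cancel₀ _ hy', Real.norm_eq_abs]
  refine (abs_sub _ _).trans (add_le_add_left ?_ _)
  rw [abs_mul, abs_of_nonneg hs0]
  have := abs_clamp_le hρ (‖y‖ - 1)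
  nlinarith [abs_nonneg m]

lemma abs_norm_shellPush_sub_one_lt (hy : y ≠ 0) (hρ : 0 < ρ) (hρ1 : ρ ≤ 1) (hs0 : 0 ≤ s)
    (hs1 : s < 1) : |‖shellPush ρ s y‖ - 1| < ρ := by
  rw [norm_shellPush hy hρ.le hρ1 hs0 hs1.le, add_sub_cancel_left, abs_mul, abs_of_nonneg hs0]
  have := abs_clamp_le hρ.le (‖y‖ - 1)
  nlinarith

end ShellPush

/-- The Tietze displacement costs 4ρ and the radial push at most ρ + 4ρ, giving 9ρ. The bound ρ <
1/4 keeps the displaced points away from the origin. -/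
lemma exists_shell_filling_map {n : ℕ} (hn : 1 ≤ n) {ρ : ℝ} (hρ : 0 < ρ) (hρ1 : ρ < 1 / 4) :
    ∃ (f : C(UnitSphere n, EuclideanSpace ℝ (Fin (n + 1)))) (E : Set (UnitSphere n)),
      volume {r : ℝ | ∃ a ∈ E, ∃ b ∈ E, angularDist a b = r} = 0 ∧
      (∀ x ∉ E, f x ∈ interior (Set.range f)) ∧ ∀ x, ‖f x - x‖ ≤ 9 * ρ := by
  obtain ⟨m, x, Φ, hx, hΦc, hΦi, hΦd, hΦ⟩ := exists_dense_cantor_family hn hρ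
  set F : Fin m × (ℕ → Bool) → UnitSphere n := fun p => Φ p.1 p.2 with hF
  have hFc : Continuous F := continuous_prod_of_discrete_left.2 hΦc
  have hFe : IsClosedEmbedding F := hFc.isClosedEmbedding fun p q h =>
    Prod.ext (hΦi _ _ _ _ h).1 (hΦi _ _ _ _ h).2
  set K : Set (EuclideanSpace ℝ (Fin (n + 1))) := {y | |‖y‖ - 1| ≤ ρ} with hK
  -- Every point of K is within 2ρ of some center (radial projection, then net), so radius 3ρ
  -- suffices to cover K.
  have hq : ∀ i, ∃ q : (ℕ → Bool) → EuclideanSpace ℝ (Fin (n + 1)), Continuous q ∧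
      Set.range q = K ∩ Metric.closedBall (x i : EuclideanSpace ℝ (Fin (n + 1))) (3 * ρ) := by
    intro i
    have hcomp : IsCompact
        (K ∩ Metric.closedBall (x i : EuclideanSpace ℝ (Fin (n + 1))) (3 * ρ)) :=
      (isCompact_closedBall _ _).inter_left (isClosed_le (by fun_prop) continuous_const)
    have : CompactSpace
        (K ∩ Metric.closedBall (x i : EuclideanSpace ℝ (Fin (n + 1))) (3 * ρ) : Set _) :=
      isCompact_iff_compactSpace.1 hcomp
    have : Nonempty
        (K ∩ Metric.closedBall (x i : EuclideanSpace ℝ (Fin (n + 1))) (3 * ρ) : Set _) :=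
      ⟨⟨x i, by simp [hK, hρ.le], Metric.mem_closedBall_self (by positivity)⟩⟩
    obtain ⟨q, hqc, hqs⟩ := exists_nat_bool_continuous_surjective_of_compact
      (K ∩ Metric.closedBall (x i : EuclideanSpace ℝ (Fin (n + 1))) (3 * ρ) : Set _)
    exact ⟨fun c => q c, continuous_subtype_val.comp hqc, by
      rw [show (fun c => (q c : EuclideanSpace ℝ (Fin (n + 1)))) = Subtype.val ∘ q from rfl,
        hqs.range_comp, Subtype.range_coe]⟩
  choose q hqc hqr using hq
  have hqmem : ∀ i c, q i c ∈ K ∩ Metric.closedBall (x i : EuclideanSpace ℝ (Fin (n + 1))) (3 * ρ) :=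
    fun i c => hqr i ▸ Set.mem_range_self c
  have hQc : Continuous fun p : Fin m × (ℕ → Bool) => q p.1 p.2 :=
    continuous_prod_of_discrete_left.2 hqc
  have := Metric.instTietzeExtensionClosedBall ℝ (0 : EuclideanSpace ℝ (Fin (n + 1)))
    (show 0 < 4 * ρ by positivity)
  obtain ⟨g, hg, hgF⟩ := ContinuousMap.exists_extension_forall_mem hFe
    (⟨fun p => q p.1 p.2 - F p, hQc.sub (continuous_subtype_val.comp hFc)⟩ :
      C(Fin m × (ℕ → Bool), EuclideanSpace ℝ (Fin (n + 1))))
    (t := Metric.closedBall 0 (4 * ρ)) (by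
      rintro ⟨i, c⟩
      have h1 := (hqmem i c).2
      have h2 := hΦd i c
      rw [Metric.mem_closedBall] at h1
      rw [Subtype.dist_eq] at h2
      rw [mem_closedBall_zero_iff, ContinuousMap.coe_mk, ← dist_eq_norm]
      have := dist_triangle_right (q i c) (F (i, c) : EuclideanSpace ℝ (Fin (n + 1))) (x i)
      simp only [hF] at this ⊢
      linarith)
  have hgq : ∀ i c, g (Φ i c) = q i c - Φ i c := fun i c => DFunLike.congr_fun hgF (i, c)
  have hgn : ∀ z, ‖g z‖ ≤ 4 * ρ := fun z => mem_closedBall_zero_iff.1 (hg z)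
  set y : UnitSphere n → EuclideanSpace ℝ (Fin (n + 1)) := fun z => z + g z with hy
  have hyc : Continuous y := by fun_prop
  have hyn : ∀ z, |‖y z‖ - 1| ≤ 4 * ρ := by
    intro z
    have h := abs_norm_sub_norm_le (y z) (z : EuclideanSpace ℝ (Fin (n + 1)))
    rw [norm_eq_of_mem_sphere, hy, add_sub_cancel_left] at h
    exact h.trans (hgn z)
  have hy0 : ∀ z, y z ≠ 0 := by
    intro z h
    have := hyn z
    rw [h, norm_zero, zero_sub, abs_neg, abs_one] at this
    linarith
  set E := Set.range F with hE
  -- Equal to 1 exactly on the closed set E: the push fixes the prescribed values in K there and is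
  -- strictly contracting elsewhere.
  set s : UnitSphere n → ℝ := fun z => max 0 (1 - Metric.infDist z E) with hs
  have hsc : Continuous s :=
    continuous_const.max (continuous_const.sub (Metric.continuous_infDist_pt _))
  have hs0 : ∀ z, 0 ≤ s z := fun z => le_max_left _ _
  have hs1 : ∀ z, s z ≤ 1 := fun z =>
    max_le zero_le_one (sub_le_self _ Metric.infDist_nonneg)
  have hfc : Continuous fun z => shellPush ρ (s z) (y z) := by
    unfold shellPush
    refine Continuous.smul (Continuous.div ?_ hyc.norm fun z => norm_ne_zero_iff.2 (hy0 z)) hyc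
    fun_prop
  have hKr : K ⊆ Set.range fun z => shellPush ρ (s z) (y z) := by
    intro w hw
    have hw' : |‖w‖ - 1| ≤ ρ := hw
    have hw0 : w ≠ 0 := by
      rintro rfl
      rw [norm_zero, zero_sub, abs_neg, abs_one] at hw'
      linarith
    have hwn := norm_ne_zero_iff.2 hw0
    obtain ⟨i, hi⟩ := hx ⟨‖w‖⁻¹ • w, by simp [norm_smul, hwn]⟩
    have hdist : dist w (‖w‖⁻¹ • w) ≤ ρ := by
      have : w - ‖w‖⁻¹ • w = ((‖w‖ - 1) / ‖w‖) • w := by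
        nth_rewrite 1 [← one_smul ℝ w]
        rw [← sub_smul]
        congr 1
        field_simp
      rw [dist_eq_norm, this, norm_smul, norm_div, norm_norm, div_mul_cancel₀ _ hwn]
      exact hw'
    obtain ⟨c, hc⟩ : w ∈ Set.range (q i) := by
      rw [hqr]
      refine ⟨hw, ?_⟩
      rw [Subtype.dist_eq] at hi
      rw [Metric.mem_closedBall]
      have := dist_triangle w (‖w‖⁻¹ • w) (x i : EuclideanSpace ℝ (Fin (n + 1)))
      linarith
    refine ⟨Φ i c, ?_⟩
    have h1 : y (Φ i c) = w := by rw [hy, ← hc]; simp [hgq]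
    have h2 : s (Φ i c) = 1 := by
      simp [hs, Metric.infDist_zero_of_mem (show Φ i c ∈ E from ⟨(i, c), rfl⟩)]
    simp only [h1, h2]
    exact shellPush_one hw0 hw'
  refine ⟨⟨_, hfc⟩, E, ?_, fun z hz => ?_, fun z => ?_⟩
  · refine measure_mono_null ?_ hΦ
    rintro r ⟨_, ⟨⟨i, c⟩, rfl⟩, _, ⟨⟨j, d⟩, rfl⟩, rfl⟩
    exact ⟨i, c, j, d, rfl⟩
  · have hEne : E.Nonempty := ⟨_, ⟨(hx z).choose, fun _ => false⟩, rfl⟩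
    have hpos := (hFe.isClosed_range.notMem_iff_infDist_pos hEne).1 hz
    have hopen : IsOpen {w : EuclideanSpace ℝ (Fin (n + 1)) | |‖w‖ - 1| < ρ} :=
      isOpen_lt (by fun_prop) continuous_const
    refine interior_maximal (fun w hw => hKr (show |‖w‖ - 1| ≤ ρ from le_of_lt hw)) hopen ?_
    exact abs_norm_shellPush_sub_one_lt (hy0 z) hρ (by linarith) (hs0 z)
      (max_lt one_pos (sub_lt_self _ hpos))
  · have h1 := norm_shellPush_sub_le (hy0 z) hρ.le (hs0 z) (hs1 z)
    have h2 : ‖y z - z‖ ≤ 4 * ρ := by rw [hy, add_sub_cancel_left]; exact hgn z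
    have h3 := norm_sub_le_norm_sub_add_norm_sub (shellPush ρ (s z) (y z)) (y z)
      (z : EuclideanSpace ℝ (Fin (n + 1)))
    rw [ContinuousMap.coe_mk]
    linarith [hyn z]

/-- Null-measurability for `volume` is Lebesgue measurability. -/
theorem mainTheorem5 (n : ℕ) (hn : 1 ≤ n) :
    ∃ f : ℕ → C(UnitSphere n, EuclideanSpace ℝ (Fin (n + 1))),
      (∀ k : ℕ, NullMeasurableSet (topologicalDistanceSet angularDist (f k)) (volume : Measure ℝ)) ∧
      Tendsto (fun k : ℕ => (volume : Measure ℝ) (topologicalDistanceSet angularDist (f k)))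
        atTop (𝓝 0) := by
  have key : ∀ k : ℕ, ∃ f : C(UnitSphere n, EuclideanSpace ℝ (Fin (n + 1))),
      NullMeasurableSet (topologicalDistanceSet angularDist f) (volume : Measure ℝ) ∧
      volume (topologicalDistanceSet angularDist f) ≤
        ENNReal.ofReal (Real.pi / 2 * (18 * (1 / 5 * (1 / ((k : ℝ) + 1))))) := by
    intro k
    have hk : 1 / ((k : ℝ) + 1) ≤ 1 := by
      rw [div_le_one (by positivity)]
      linarith [(Nat.cast_nonneg k : (0 : ℝ) ≤ k)]
    -- The factor 1/5 ensures ρ < 1/4.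
    set ρ : ℝ := 1 / 5 * (1 / ((k : ℝ) + 1)) with hρ
    have hρ0 : 0 < ρ := by positivity
    obtain ⟨f, E, hE, hfE, hf⟩ := exists_shell_filling_map hn hρ0 (by linarith)
    refine ⟨f, topologicalDistanceSet_measure_bound f E hE hfE fun a b hab => ?_⟩
    refine (angularDist_le_mul_dist a b).trans ?_
    refine mul_le_mul_of_nonneg_left ?_ (by positivity)
    rw [Subtype.dist_eq]
    have h1 := hf a
    have h2 := hf b
    rw [← dist_eq_norm] at h1 h2
    rw [hab] at h1
    linarith [dist_triangle_left (a : EuclideanSpace ℝ (Fin (n + 1))) b (f b)]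
  choose f hf hfv using key
  refine ⟨f, hf, tendsto_of_tendsto_of_tendsto_of_le_of_le tendsto_const_nhds ?_
    (fun _ => zero_le) hfv⟩
  have := (((tendsto_one_div_add_atTop_nhds_zero_nat (𝕜 := ℝ)).const_mul (1 / 5)).const_mul
    18).const_mul (Real.pi / 2)
  simpa using ENNReal.tendsto_ofReal this
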